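/- Let $K$ be a field of characteristic $0$, $x=(x_1,\dots,x_n)$, $\partial_i=\partial/\partial x_i$, and let $y$ be a parameter commuting with $x$ and $\partial$. Let $D[y]\subset\widehat{\mathcal D}[y]$ be the rings of differential operators $\sum a_{\alpha\beta\gamma}x^\alpha\partial^\beta y^\gamma$ with total symbol $\sum a_{\alpha\beta\gamma}x^\alpha\xi^\beta y^\gamma$ in $K[x,\xi,y]$, respectively in $K[[x]][y,\xi]$. Exponents of such terms are elements $\mu=(\alpha,\beta,\gamma)$ of $\mathbb Z_{\ge0}^{2n+1}$, with total degree $|\mu|=|\alpha|+|\beta|+\gamma$ and $e$-degree $|\beta|+\gamma$; $\mathrm{Exps}(P)$ is the set of exponents of $P$, $\mathrm{ord}_e(P)$ is the maximal $e$-degree of the terms of $P$ (we put $\mathrm{ord}_e(0)=0$), and $\mathrm{in}_e(P)$ is the part of the total symbol of $P$ of $e$-degree $\mathrm{ord}_e(P)$. Fix a term order $<_1$ on the monomials $x^\alpha\xi^\beta y^\gamma$. The order $<$ compares first the $e$-degree, then $-|\alpha|$, then uses $<_1$; the order $<_r$ compares first minus the total degree, then uses $<_1$. $\mathrm{LE}$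 and $\mathrm{LT}$ denote the leading exponent and the leading term (with its coefficient). For $\alpha(1),\dots,\alpha(s)\in\mathbb Z_{\ge0}^{2n+1}$ put $\Delta^i=(\alpha(i)+\mathbb Z_{\ge0}^{2n+1})\setminus(\Delta^1\cup\dots\cup\Delta^{i-1})$ and $\overline\Delta=\mathbb Z_{\ge0}^{2n+1}\setminus(\Delta^1\cup\dots\cup\Delta^s)$. **$K[[x]]$-approximate-division$(f,g_1,\dots,g_s,<_r,B)$** (for symbols in all the variables $x,\xi,y$). Start with $\overline F\leftarrow f$, $\overline q_i\leftarrow0$, $\overline r\leftarrow0$. While $\overline F\ne0$ and $|\mathrm{LE}_{<_r}(\overline F)|<B$: divide $\overline F$ by the leading terms, i.e. take the unique $q'_i,r'$ with $\overline F=\sum_i q'_i\,\mathrm{LT}_{<_r}(g_i)+r'$, $\mathrm{LE}_{<_r}(g_i)+\mathrm{Exps}(q'_i)\subset\Delta^i$ and $\mathrm{Exps}(r')\subset\overline\Delta$, for the partition attached to $(\mathrm{LE}_{<_r}(g_1),\dots,\mathrm{LE}_{<_r}(g_s))$; then put $\overline q_i\leftarrow\overline q_i+q'_i$, $\overline r\leftarrow\overline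 r+r'$, $\overline F\leftarrow-\sum_i q'_i\,(g_i-\mathrm{LT}_{<_r}(g_i))$. Return $\overline q_1,\dots,\overline q_s,\overline r,\overline F$. **$\widehat{\mathcal D}$-approximate-division$(P,P_1,\dots,P_s,N)$**, with input $P,P_1,\dots,P_s\in D[y]$, all $P_i\neq0$, and an integer $N>0$. Put $\overline Q_i\leftarrow0$, $\overline R\leftarrow P$, $m_0\leftarrow\mathrm{ord}_e(P)$; for $0\le k\le m_0$ let $$M_k=\max\{\,|\mathrm{LE}_<(P_i)|+2(k-\mathrm{ord}_e(P_i))\;:\;k\ge\mathrm{ord}_e(P_i)\,\}\qquad(\max\emptyset=0),$$ and put $\mathrm{Bound}\leftarrow N+\sum_{k=0}^{m_0}M_k$. For $k=m_0,m_0-1,\dots,0$: let $\overline r$ be the total symbol of the part of $\overline R$ of $e$-degree $k$ and total degree $<\mathrm{Bound}$; let $\overline q'_1,\dots,\overline q'_s$ be the quotients returned by $K[[x]]$-approximate-division$(\overline r,\mathrm{in}_e(P_1),\dots,\mathrm{in}_e(P_s),<_r,\mathrm{Bound})$; let $\overline Q'_i$ be $\overline q'_i$ with $\xi$ replaced by $\partial$;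 put $\overline R\leftarrow\overline R-\sum_i\overline Q'_iP_i$, $\overline Q_i\leftarrow\overline Q_i+\overline Q'_i$, $\mathrm{Bound}\leftarrow\mathrm{Bound}-M_k$. Return $\overline Q_1,\dots,\overline Q_s,\overline R$. **Theorem.** 1. On every such input the algorithm $\widehat{\mathcal D}$-approximate-division terminates. 2. There are unique $Q_1,\dots,Q_s,R\in\widehat{\mathcal D}[y]$ (Castro's quotients and remainder) with $P=\sum_iQ_iP_i+R$, $\mathrm{LE}_<(P_i)+\mathrm{Exps}(Q_i)\subset\Delta^i$ for all $i$ and $\mathrm{Exps}(R)\subset\overline\Delta$, for the partition attached to $(\mathrm{LE}_<(P_1),\dots,\mathrm{LE}_<(P_s))$. 3. The output satisfies $\overline Q_1,\dots,\overline Q_s,\overline R\in D[y]$ and $P=\sum_i\overline Q_iP_i+\overline R$. For every $i$, the terms of $\overline Q_i$ of total degree $<N-|\mathrm{LE}_<(P_i)|$ agree with those of $Q_i$, and the terms of $\overline R$ of total degree $<N$ agree with those of $R$. 4. For integers $i$ and $m\ge0$ let $T(i)$ be the set of $A\in\widehat{\mathcal D}[y]$ all of whose terms have total degree $\ge i$,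 and let $D(m)$ be the set of $A\in\widehat{\mathcal D}[y]$ with $\mathrm{ord}_e(A)=m$. Then $(T(i)\cap D(m))\cdot T(j)\subset T(i+j-2m)$ for all integers $i,j$ and $m\geq 0$. -/

import Mathlib

noncomputable section

namespace DDiv

/-! ### Variables, exponents and total symbols -/

/-- The `2n + 1` commuting variables `x₁,…,xₙ`, `ξ₁,…,ξₙ`, `y`
(`ξᵢ` stands for `∂ᵢ = ∂/∂xᵢ`, and `y` is a parameter commuting with everything). -/
abbrev Var (n : ℕ) := Fin n ⊕ Fin n ⊕ Unit

/-- The variable `xᵢ`. -/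
abbrev xv {n : ℕ} (i : Fin n) : Var n := Sum.inl i

/-- The variable `ξᵢ`. -/
abbrev xiv {n : ℕ} (i : Fin n) : Var n := Sum.inr (Sum.inl i)

/-- The variable `y`. -/
abbrev yv {n : ℕ} : Var n := Sum.inr (Sum.inr ())

/-- Exponent vectors in `ℤ_{≥0}^{2n+1}`.  The total degree `|μ|` is `Finsupp.degree μ`. -/
abbrev Expo (n : ℕ) := Var n →₀ ℕ

/-- Formal sums `∑ a_{αβγ} x^α ξ^β y^γ`.  A differential operator is represented by its
total symbol, i.e. by the coefficients of its normally ordered expression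
`∑ a_{αβγ} x^α ∂^β y^γ`; passing from an operator to its total symbol, or replacing `ξ` by `∂`,
is therefore the identity on this type.  The operation `*` of this type is the product of
commuting symbols; the product of operators is `dmul` below. -/
abbrev Sym (n : ℕ) (K : Type*) := MvPowerSeries (Var n) K

/-- The degree of an exponent for the weight vector `e`, which is `0` on the `xᵢ`, and `1` on `y`
and on the `ξᵢ`. -/
def eDeg {n : ℕ} (μ : Expo n) : ℕ := (∑ i, μ (xiv i)) + μ yv

/-- The total degree in the variables `x`. -/
def xDeg {n : ℕ} (μ : Expo n) : ℕ := ∑ i, μ (xv i)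

variable {n : ℕ} {K : Type*} [Field K]

/-- The set of exponents appearing in `P`. -/
def Exps (P : Sym n K) : Set (Expo n) := {μ | MvPowerSeries.coeff μ P ≠ 0}

/-- `P ∈ D̂[y]`, i.e. the total symbol lies in `K[[x]][y, ξ]`: the `e`-degrees of the terms are
bounded (equivalently, only finitely many monomials `ξ^β y^γ` occur, with arbitrary coefficients
in `K[[x]]`). -/
def IsDHat (P : Sym n K) : Prop := ∃ m : ℕ, ∀ μ ∈ Exps P, eDeg μ ≤ m

/-- `P ∈ D[y]`, i.e. the total symbol is a polynomial. -/
def IsD (P : Sym n K) : Prop := (Exps P).Finite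

/-! ### Multiplication of differential operators -/

/-- The iterated partial derivative `∏ᵢ (∂/∂vᵢ)^{νᵢ}` of a formal sum. -/
def iterDeriv (v : Fin n → Var n) (ν : Fin n →₀ ℕ) (f : Sym n K) : Sym n K :=
  (List.finRange n).foldr (fun i g => (MvPowerSeries.pderiv K (v i))^[ν i] g) f

/-- The product `P · Q` of differential operators, in terms of total symbols (Leibniz rule):
`(PQ)(x, ξ, y) = ∑_ν (1/ν!) (∂^ν P/∂ξ^ν) (∂^ν Q/∂x^ν)`.
For `P` in `D̂[y]` only finitely many `ν` contribute. -/
def dmul (P Q : Sym n K) : Sym n K :=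
  ∑ᶠ ν : Fin n →₀ ℕ, (((∏ i, (ν i).factorial : ℕ) : K)⁻¹) •
    (iterDeriv xiv ν P * iterDeriv xv ν Q)

/-! ### Orders, leading exponents, slices -/

/-- The order `<`: compare first the `e`-degree, then minus the total degree in `x`, then the
term order `m`. -/
def ltD (m : MonomialOrder (Var n)) (μ μ' : Expo n) : Prop :=
  eDeg μ < eDeg μ' ∨ (eDeg μ = eDeg μ' ∧
    (xDeg μ' < xDeg μ ∨ (xDeg μ = xDeg μ' ∧ m.toSyn μ < m.toSyn μ')))

/-- The order `<_r`: compare first minus the total degree, then the term order `m`. -/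
def ltR (m : MonomialOrder (Var n)) (μ μ' : Expo n) : Prop :=
  μ'.degree < μ.degree ∨ (μ.degree = μ'.degree ∧ m.toSyn μ < m.toSyn μ')

open Classical in
/-- The leading exponent of `P` with respect to the strict order `lt`: the exponent of `P` which
is larger than all others (it exists for `P ≠ 0` in `D̂[y]` when `lt` is `ltD m` or `ltR m`). -/
def leadExp (lt : Expo n → Expo n → Prop) (P : Sym n K) : Expo n :=
  if h : ∃ μ, μ ∈ Exps P ∧ ∀ μ' ∈ Exps P, μ' ≠ μ → lt μ' μ then h.choose else 0

/-- The leading coefficient. -/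
def leadCoeff (lt : Expo n → Expo n → Prop) (P : Sym n K) : K :=
  MvPowerSeries.coeff (leadExp lt P) P

/-- `Rest(P) = P - LT(P)`. -/
def rest (lt : Expo n → Expo n → Prop) (P : Sym n K) : Sym n K :=
  P - MvPowerSeries.monomial (leadExp lt P) (leadCoeff lt P)

/-- The `e`-order of `P`: the maximum of the `e`-degrees of its terms (`0` for `P = 0`). -/
def ordE (P : Sym n K) : ℕ := sSup (eDeg '' Exps P)

open Classical in
/-- The part of `P` consisting of the terms whose exponents lie in `S`. -/
def part (S : Set (Expo n)) (P : Sym n K) : Sym n K :=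
  fun μ => if μ ∈ S then MvPowerSeries.coeff μ P else 0

/-- The initial part `in_e(P)`: the part of `P` of `e`-degree `ord_e(P)`. -/
def inE (P : Sym n K) : Sym n K := part {μ | eDeg μ = ordE P} P

/-- `P ∈ T(i)`: every term of `P` has total degree at least `i`. -/
def InT (i : ℤ) (P : Sym n K) : Prop := ∀ μ ∈ Exps P, i ≤ (μ.degree : ℤ)

/-! ### Partitions of the exponents and division -/

/-- `μ ∈ Δ^i`, for the partition attached to `a 0, a 1, …`:
`Δ^i = (a i + ℤ_{≥0}^{2n+1}) ∖ ⋃_{j < i} Δ^j`. -/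
def InDelta {s : ℕ} (a : Fin s → Expo n) (i : Fin s) (μ : Expo n) : Prop :=
  a i ≤ μ ∧ ∀ j, j < i → ¬ a j ≤ μ

/-- `μ ∈ Δ̄`, the complement of all the `Δ^i`. -/
def InDeltaBar {s : ℕ} (a : Fin s → Expo n) (μ : Expo n) : Prop := ∀ i, ¬ a i ≤ μ

/-- `Q₁,…,Q_s` and `R` are the quotients and the remainder of Castro's division in `D̂[y]` of `P`
by `P₁,…,P_s` with respect to `<`. -/
def IsDHatDivision (m : MonomialOrder (Var n)) {s : ℕ} (P : Sym n K) (Ps : Fin s → Sym n K)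
    (Q : Fin s → Sym n K) (R : Sym n K) : Prop :=
  (∀ i, IsDHat (Q i)) ∧ IsDHat R ∧
  P = ∑ i, dmul (Q i) (Ps i) + R ∧
  (∀ i, ∀ μ ∈ Exps (Q i),
    InDelta (fun j => leadExp (ltD m) (Ps j)) i (leadExp (ltD m) (Ps i) + μ)) ∧
  (∀ μ ∈ Exps R, InDeltaBar (fun j => leadExp (ltD m) (Ps j)) μ)

/-! ### The algorithm `K[[x]]`-approximate-division -/

open Classical in
/-- The quotient `q'_i` returned by mono-div: `F` is divided by the leading terms of the `g_j` with
respect to `<_r`; each term of `F` with exponent in `Δ^i` is divided by `LT(g_i)`. -/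
def monoDivQuot (m : MonomialOrder (Var n)) {s : ℕ} (g : Fin s → Sym n K) (F : Sym n K)
    (i : Fin s) : Sym n K :=
  fun μ => if InDelta (fun j => leadExp (ltR m) (g j)) i (leadExp (ltR m) (g i) + μ)
    then MvPowerSeries.coeff (leadExp (ltR m) (g i) + μ) F / leadCoeff (ltR m) (g i) else 0

/-- The remainder `r'` returned by mono-div. -/
def monoDivRem (m : MonomialOrder (Var n)) {s : ℕ} (g : Fin s → Sym n K) (F : Sym n K) : Sym n K :=
  part {μ | InDeltaBar (fun j => leadExp (ltR m) (g j)) μ} F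

/-- The variables `F̄, q̄₁,…,q̄_s, r̄` of `K[[x]]`-approximate-division. -/
structure PSState (n : ℕ) (K : Type*) (s : ℕ) where
  F : Sym n K
  q : Fin s → Sym n K
  r : Sym n K

/-- The condition of the while-loop: `F̄ ≠ 0` and `|LE_{<_r}(F̄)| < B`. -/
def psCond (m : MonomialOrder (Var n)) {s : ℕ} (B : ℕ) (S : PSState n K s) : Prop :=
  S.F ≠ 0 ∧ (leadExp (ltR m) S.F).degree < B

/-- The body of the while-loop. -/
def psBody (m : MonomialOrder (Var n)) {s : ℕ} (g : Fin s → Sym n K) (S : PSState n K s) :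
    PSState n K s where
  F := - ∑ i, monoDivQuot m g S.F i * rest (ltR m) (g i)
  q := fun i => S.q i + monoDivQuot m g S.F i
  r := S.r + monoDivRem m g S.F

/-- `WhileRun cond body S T`: the loop `while cond do body`, started in state `S`, stops after
finitely many steps, and then is in state `T`. -/
inductive WhileRun {St : Type*} (cond : St → Prop) (body : St → St) : St → St → Prop
  | done (S : St) (h : ¬ cond S) : WhileRun cond body S S
  | step (S T : St) (h : cond S) (hrun : WhileRun cond body (body S) T) : WhileRun cond body S T

/-- `K[[x]]`-approximate-division of `f` by `g₁,…,g_s` with respect to `<_r` (in all the variables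
`x, ξ, y`) with bound `B` stops and returns `T.q`, `T.r`, `T.F`. -/
def PSApproxDivRun (m : MonomialOrder (Var n)) {s : ℕ} (f : Sym n K) (g : Fin s → Sym n K) (B : ℕ)
    (T : PSState n K s) : Prop :=
  WhileRun (psCond m B) (psBody m g) ⟨f, fun _ => 0, 0⟩ T

/-! ### The algorithm `D̂`-approximate-division -/

/-- `M_k = max {|LE_<(P_i)| + 2 (k - ord_e(P_i)) : k ≥ ord_e(P_i)}`, with `max ∅ = 0`. -/
def Mk (m : MonomialOrder (Var n)) {s : ℕ} (Ps : Fin s → Sym n K) (k : ℕ) : ℕ :=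
  (Finset.univ.filter (fun i => ordE (Ps i) ≤ k)).sup
    (fun i => (leadExp (ltD m) (Ps i)).degree + 2 * (k - ordE (Ps i)))

/-- The variables `Q̄₁,…,Q̄_s, R̄, Bound` of `D̂`-approximate-division. -/
structure DState (n : ℕ) (K : Type*) (s : ℕ) where
  Q : Fin s → Sym n K
  R : Sym n K
  bound : ℕ

/-- One pass through the body of the for-loop, for the index `k`: the call of
`K[[x]]`-approximate-division in it stops, and the state `S` is changed into `S'`.
(The subtraction `Bound - M_k` is never truncated, as `Bound ≥ N + M_k + ⋯ + M_0` at this point.) -/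
def DStep (m : MonomialOrder (Var n)) {s : ℕ} (Ps : Fin s → Sym n K) (k : ℕ)
    (S S' : DState n K s) : Prop :=
  ∃ T : PSState n K s,
    PSApproxDivRun m (part {μ | eDeg μ = k ∧ μ.degree < S.bound} S.R) (fun i => inE (Ps i))
      S.bound T ∧
    S'.R = S.R - ∑ i, dmul (T.q i) (Ps i) ∧
    (∀ i, S'.Q i = S.Q i + T.q i) ∧
    S'.bound = S.bound - Mk m Ps k

/-- The for-loop `for k = c - 1, c - 2, …, 0`. -/
def DLoop (m : MonomialOrder (Var n)) {s : ℕ} (Ps : Fin s → Sym n K) :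
    ℕ → DState n K s → DState n K s → Prop
  | 0, S, S' => S' = S
  | k + 1, S, S' => ∃ S₁, DStep m Ps k S S₁ ∧ DLoop m Ps k S₁ S'

/-- `D̂`-approximate-division, on the input `P, P₁,…,P_s, N`, stops and returns `Q̄₁,…,Q̄_s, R̄`. -/
def DHatApproxDivRun (m : MonomialOrder (Var n)) {s : ℕ} (P : Sym n K) (Ps : Fin s → Sym n K)
    (N : ℕ) (Qbar : Fin s → Sym n K) (Rbar : Sym n K) : Prop :=
  ∃ b : ℕ, DLoop m Ps (ordE P + 1)
    ⟨fun _ => 0, P, N + ∑ k ∈ Finset.range (ordE P + 1), Mk m Ps k⟩ ⟨Qbar, Rbar, b⟩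

end DDiv

end

/-!
Castro's division by `P_1, …, P_s` is recast as a fixed point problem.  Dividing a symbol `c` by
the leading terms of the `P_i` is explicit (`divQuot`): every term is assigned to the `Δ^i` or to
`Δ̄` that contains it, so `c` and its quotients and remainder determine each other.  Replacing the
leading terms by the `P_i` themselves produces an error `defect c`, additive in `c`, and the
divisions of `P` correspond to the solutions of `c = P - defect c`.  By the Leibniz rule every
term of `defect c` is strictly smaller for `<` than some term of `c`
(`exists_of_mem_exps_defect`).  As there are no infinite increasing sequences of exponents of
bounded `e`-degree (`wellFounded_ltD_swap`), the equation can be solved, and has a unique solution,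
by recursion from large exponents to small ones (`exists_eq_sub_defect`, `eq_of_eq_sub_defect`).

The summand with index `ν` of the Leibniz rule lowers the `e`-degree by `|ν|` and the total degree
by `2|ν|`, where `|ν|` is at most the `e`-order of the left factor.  This is the estimate for
`T(i)` and `D(d)`.  It also shows that terms pass from `e`-degree `k` to lower ones at the cost of
at most `M_k` in total degree, so that the bounds `B_k = N + M_0 + ⋯ + M_k` on the total degrees in
`e`-degree `k` carry over from `P` to `c` (`le_degree_of_eq_sub_defect`).

The inner loop of the algorithm terminates because the leading exponents decrease for `<_r` and
only finitely many exponents have total degree `< B`.  Step `k` of the outer loop reduces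
everything of `e`-degree `k` and total degree `< B_k`, and later steps do not touch this
`e`-degree (`DInv`).  Hence the output is an exact division up to an error `E` whose terms of
`e`-degree `k` have total degree `≥ B_k`.  Dividing `E` exactly and adding the results gives the
Castro division of `P`, by uniqueness, and the contribution of `E` lies in total degree
`≥ N - |LE(P_i)|` in the quotients and `≥ N` in the remainder (`DInv.agree`).
-/

open MvPowerSeries (coeff monomial coeff_mul_monomial)

namespace DDiv

variable {n : ℕ} {K : Type*} [Field K]

/-! ### Exponents and supports -/

theorem eDeg_add (μ ν : Expo n) : eDeg (μ + ν) = eDeg μ + eDeg ν := by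
  simp only [eDeg, Finsupp.add_apply, Finset.sum_add_distrib]
  ring

theorem xDeg_add (μ ν : Expo n) : xDeg (μ + ν) = xDeg μ + xDeg ν := by
  simp only [xDeg, Finsupp.add_apply, Finset.sum_add_distrib]

theorem degree_eq_xDeg_add_eDeg (μ : Expo n) : μ.degree = xDeg μ + eDeg μ := by
  simp [Finsupp.degree_eq_sum, xDeg, eDeg]

theorem mem_exps {P : Sym n K} {μ : Expo n} : μ ∈ Exps P ↔ coeff μ P ≠ 0 := Iff.rfl

theorem coeff_eq_zero_of_notMem {P : Sym n K} {μ : Expo n} (h : μ ∉ Exps P) : coeff μ P = 0 := by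
  simpa [mem_exps] using h

theorem exps_add_subset (P Q : Sym n K) : Exps (P + Q) ⊆ Exps P ∪ Exps Q := by
  intro μ h
  by_contra h'
  simp only [Set.mem_union, not_or, mem_exps, not_not] at h'
  exact h (by rw [map_add, h'.1, h'.2, add_zero])

theorem exps_neg (P : Sym n K) : Exps (-P) = Exps P := by
  ext μ
  simp [mem_exps]

theorem exps_sub_subset (P Q : Sym n K) : Exps (P - Q) ⊆ Exps P ∪ Exps Q := by
  rw [sub_eq_add_neg, ← exps_neg Q]
  exact exps_add_subset _ _

theorem exists_mem_exps_of_sum {ι : Type*} {t : Finset ι} {f : ι → Sym n K} {μ : Expo n}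
    (h : μ ∈ Exps (∑ i ∈ t, f i)) : ∃ i ∈ t, μ ∈ Exps (f i) := by
  rw [mem_exps, map_sum] at h
  exact Finset.exists_ne_zero_of_sum_ne_zero h

theorem exists_mem_exps_of_mul {A B : Sym n K} {μ : Expo n} (h : μ ∈ Exps (A * B)) :
    ∃ α ∈ Exps A, ∃ β ∈ Exps B, μ = α + β := by
  classical
  rw [mem_exps, MvPowerSeries.coeff_mul] at h
  obtain ⟨p, hp, hne⟩ := Finset.exists_ne_zero_of_sum_ne_zero h
  exact ⟨p.1, left_ne_zero_of_mul hne, p.2, right_ne_zero_of_mul hne,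
    (Finset.HasAntidiagonal.mem_antidiagonal.mp hp).symm⟩

open Classical in
theorem coeff_part (S : Set (Expo n)) (P : Sym n K) (μ : Expo n) :
    coeff μ (part S P) = if μ ∈ S then coeff μ P else 0 := rfl

theorem mem_exps_part {S : Set (Expo n)} {P : Sym n K} {μ : Expo n} :
    μ ∈ Exps (part S P) ↔ μ ∈ S ∧ μ ∈ Exps P := by
  classical
  rw [mem_exps, coeff_part, mem_exps]
  by_cases h : μ ∈ S <;> simp [h]

theorem IsD.add {P Q : Sym n K} (hP : IsD P) (hQ : IsD Q) : IsD (P + Q) :=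
  (hP.union hQ).subset (exps_add_subset P Q)

theorem IsD.neg {P : Sym n K} (hP : IsD P) : IsD (-P) := by
  rwa [IsD, exps_neg]

theorem IsD.sub {P Q : Sym n K} (hP : IsD P) (hQ : IsD Q) : IsD (P - Q) :=
  (hP.union hQ).subset (exps_sub_subset P Q)

theorem IsD.zero : IsD (0 : Sym n K) := by
  simp [IsD, Exps]

theorem IsD.sum {ι : Type*} {t : Finset ι} {f : ι → Sym n K} (h : ∀ i ∈ t, IsD (f i)) :
    IsD (∑ i ∈ t, f i) :=
  (Set.Finite.biUnion t.finite_toSet h).subset fun μ hμ => by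
    simpa using exists_mem_exps_of_sum hμ

theorem IsD.part {P : Sym n K} (hP : IsD P) (S : Set (Expo n)) : IsD (part S P) :=
  hP.subset fun _ h => (mem_exps_part.mp h).2

/-- For polynomials `A` and `B` there are only finitely many exponents below the sums `α + β` with
`α ∈ Exps A`, `β ∈ Exps B`; the exponents of `A * B` and of `dmul A B` are among them. -/
theorem IsD.of_le_add {A B P : Sym n K} (hA : IsD A) (hB : IsD B)
    (h : ∀ μ ∈ Exps P, ∃ α ∈ Exps A, ∃ β ∈ Exps B, μ ≤ α + β) : IsD P := by
  refine (Set.Finite.biUnion hA fun α _ => Set.Finite.biUnion hB fun β _ =>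
    Set.finite_Iic (α + β)).subset fun μ hμ => ?_
  simpa using h μ hμ

theorem IsD.mul {A B : Sym n K} (hA : IsD A) (hB : IsD B) : IsD (A * B) :=
  hA.of_le_add hB fun _ hμ =>
    let ⟨α, hα, β, hβ, h⟩ := exists_mem_exps_of_mul hμ
    ⟨α, hα, β, hβ, h.le⟩

theorem IsD.isDHat {P : Sym n K} (hP : IsD P) : IsDHat P := by
  obtain ⟨e, he⟩ := (hP.image eDeg).bddAbove
  exact ⟨e, fun μ hμ => he ⟨μ, hμ, rfl⟩⟩

theorem IsDHat.add {P Q : Sym n K} (hP : IsDHat P) (hQ : IsDHat Q) : IsDHat (P + Q) := by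
  obtain ⟨e, he⟩ := hP
  obtain ⟨e', he'⟩ := hQ
  refine ⟨max e e', fun μ hμ => ?_⟩
  rcases exps_add_subset P Q hμ with h | h
  · exact (he μ h).trans (le_max_left _ _)
  · exact (he' μ h).trans (le_max_right _ _)

theorem IsDHat.sub {P Q : Sym n K} (hP : IsDHat P) (hQ : IsDHat Q) : IsDHat (P - Q) := by
  rw [sub_eq_add_neg]
  exact hP.add (by simpa only [IsDHat, exps_neg] using hQ)

theorem IsDHat.sum {ι : Type*} {t : Finset ι} {f : ι → Sym n K} (h : ∀ i ∈ t, IsDHat (f i)) :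
    IsDHat (∑ i ∈ t, f i) := by
  classical
  induction t using Finset.induction_on with
  | empty => exact IsD.isDHat (by simpa using IsD.zero)
  | insert i t hi ih =>
    rw [Finset.sum_insert hi]
    exact (h i (by simp)).add (ih fun j hj => h j (by simp [hj]))

theorem IsDHat.part {P : Sym n K} (hP : IsDHat P) (S : Set (Expo n)) : IsDHat (part S P) :=
  let ⟨e, he⟩ := hP
  ⟨e, fun μ hμ => he μ (mem_exps_part.mp hμ).2⟩

theorem IsDHat.mul {P Q : Sym n K} (hP : IsDHat P) (hQ : IsDHat Q) : IsDHat (P * Q) := by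
  obtain ⟨e, he⟩ := hP
  obtain ⟨e', he'⟩ := hQ
  refine ⟨e + e', fun μ hμ => ?_⟩
  obtain ⟨α, hα, β, hβ, rfl⟩ := exists_mem_exps_of_mul hμ
  rw [eDeg_add]
  exact Nat.add_le_add (he α hα) (he' β hβ)

theorem eDeg_le_ordE {P : Sym n K} (hP : IsDHat P) {μ : Expo n} (hμ : μ ∈ Exps P) :
    eDeg μ ≤ ordE P := by
  obtain ⟨e, he⟩ := hP
  exact le_csSup ⟨e, by rintro _ ⟨ν, hν, rfl⟩; exact he ν hν⟩ ⟨μ, hμ, rfl⟩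

/-! ### The Leibniz product -/

theorem mem_exps_foldr_pderiv (v : Fin n → Var n) (ν : Fin n →₀ ℕ) (f : Sym n K)
    (l : List (Fin n)) {μ : Expo n}
    (h : μ ∈ Exps (l.foldr (fun i g => (MvPowerSeries.pderiv K (v i))^[ν i] g) f)) :
    μ + (l.map fun i => Finsupp.single (v i) (ν i)).sum ∈ Exps f := by
  have iter (w : Var n) (k : ℕ) : ∀ (g : Sym n K) (μ : Expo n),
      μ ∈ Exps ((MvPowerSeries.pderiv K w)^[k] g) → μ + Finsupp.single w k ∈ Exps g := by
    induction k with
    | zero => simp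
    | succ k ih =>
      intro g μ h
      have h' := ih _ _ h
      rw [mem_exps, MvPowerSeries.coeff_pderiv] at h'
      have := left_ne_zero_of_mul h'
      rwa [add_assoc, ← Finsupp.single_add] at this
  induction l generalizing μ with
  | nil => simpa using h
  | cons i l ih =>
    have := ih (iter _ _ _ _ h)
    rwa [add_assoc] at this

theorem mem_exps_iterDeriv {v : Fin n → Var n} {ν : Fin n →₀ ℕ} {f : Sym n K} {μ : Expo n}
    (h : μ ∈ Exps (iterDeriv v ν f)) : μ + ν.mapDomain v ∈ Exps f := by
  have := mem_exps_foldr_pderiv v ν f _ h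
  rwa [← Fin.sum_univ_def, ← Finsupp.sum_fintype ν (fun i k => Finsupp.single (v i) k)
    (by simp)] at this

theorem iterDeriv_zero (v : Fin n → Var n) (f : Sym n K) : iterDeriv v 0 f = f := by
  simp [iterDeriv]

theorem iterDeriv_add (v : Fin n → Var n) (ν : Fin n →₀ ℕ) (f g : Sym n K) :
    iterDeriv v ν (f + g) = iterDeriv v ν f + iterDeriv v ν g := by
  unfold iterDeriv
  induction List.finRange n with
  | nil => rfl
  | cons i l ih => simp only [List.foldr_cons, ih, iterate_map_add]

theorem eDeg_mapDomain_xv (ν : Fin n →₀ ℕ) : eDeg (ν.mapDomain xv) = 0 := by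
  have h : ∀ w : Fin n ⊕ Unit, ν.mapDomain xv (Sum.inr w) = 0 := fun w =>
    Finsupp.mapDomain_of_notMem_range _ _ (by simp)
  simp [eDeg, h]

theorem eDeg_mapDomain_xiv (ν : Fin n →₀ ℕ) : eDeg (ν.mapDomain xiv) = ν.degree := by
  have h : ν.mapDomain xiv yv = 0 := Finsupp.mapDomain_of_notMem_range _ _ (by simp)
  have h' : ∀ i, ν.mapDomain xiv (xiv i) = ν i := fun i =>
    Finsupp.mapDomain_apply (fun a b hab => by simpa using hab) _ _
  simp [eDeg, h, h', Finsupp.degree_eq_sum]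

/-- The summand with index `ν` of the Leibniz rule lowers the exponent `α + β` by `ν` both in the
variables `x` and in the variables `ξ`. -/
theorem exists_of_mem_exps_leibniz {A B : Sym n K} {ν : Fin n →₀ ℕ} {μ : Expo n}
    (h : μ ∈ Exps (iterDeriv xiv ν A * iterDeriv xv ν B)) :
    ∃ α ∈ Exps A, ∃ β ∈ Exps B,
      μ + (ν.mapDomain xiv + ν.mapDomain xv) = α + β ∧ ν.degree ≤ eDeg α := by
  obtain ⟨α, hα, β, hβ, rfl⟩ := exists_mem_exps_of_mul h
  refine ⟨_, mem_exps_iterDeriv hα, _, mem_exps_iterDeriv hβ, by abel, ?_⟩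
  rw [eDeg_add, eDeg_mapDomain_xiv]
  exact Nat.le_add_left _ _

theorem dmul_support_finite {A : Sym n K} (hA : IsDHat A) (B : Sym n K) :
    (Function.support fun ν : Fin n →₀ ℕ => (((∏ i, (ν i).factorial : ℕ) : K)⁻¹) •
      (iterDeriv xiv ν A * iterDeriv xv ν B)).Finite := by
  obtain ⟨e, he⟩ := hA
  refine (Finsupp.finite_of_degree_le e).subset fun ν hν => ?_
  obtain ⟨μ, hμ⟩ : ∃ μ, μ ∈ Exps (iterDeriv xiv ν A * iterDeriv xv ν B) := by
    by_contra! h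
    refine hν ?_
    have : iterDeriv xiv ν A * iterDeriv xv ν B = 0 :=
      MvPowerSeries.ext fun μ => by simpa using coeff_eq_zero_of_notMem (h μ)
    simp only [this, smul_zero]
  obtain ⟨α, hα, -, -, -, h⟩ := exists_of_mem_exps_leibniz hμ
  exact h.trans (he α hα)

theorem dmul_add_left {A A' : Sym n K} (hA : IsDHat A) (hA' : IsDHat A') (B : Sym n K) :
    dmul (A + A') B = dmul A B + dmul A' B := by
  unfold dmul
  rw [← finsum_add_distrib (dmul_support_finite hA B) (dmul_support_finite hA' B)]
  simp only [iterDeriv_add, add_mul, smul_add]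

theorem dmul_zero_left (B : Sym n K) : dmul 0 B = 0 := by
  have h0 : IsDHat (0 : Sym n K) := IsD.zero.isDHat
  simpa using dmul_add_left h0 h0 B

theorem dmul_sub_left {A A' : Sym n K} (hA : IsDHat A) (hA' : IsDHat A') (B : Sym n K) :
    dmul (A - A') B = dmul A B - dmul A' B := by
  rw [eq_sub_iff_add_eq, ← dmul_add_left (hA.sub hA') hA', sub_add_cancel]

/-- The product of operators differs from the product of symbols only by terms that come from the
summands `ν ≠ 0` of the Leibniz rule. -/
theorem exists_of_mem_exps_dmul_sub_mul {A B : Sym n K} (hA : IsDHat A) {μ : Expo n}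
    (h : μ ∈ Exps (dmul A B - A * B)) :
    ∃ ν : Fin n →₀ ℕ, ν ≠ 0 ∧ ∃ α ∈ Exps A, ∃ β ∈ Exps B,
      μ + (ν.mapDomain xiv + ν.mapDomain xv) = α + β ∧ ν.degree ≤ eDeg α := by
  classical
  set t := insert 0 (dmul_support_finite hA B).toFinset with ht
  have hsum : dmul A B - A * B = ∑ ν ∈ t.erase 0, (((∏ i, (ν i).factorial : ℕ) : K)⁻¹) •
      (iterDeriv xiv ν A * iterDeriv xv ν B) := by
    unfold dmul
    rw [finsum_eq_sum_of_support_subset (s := t) _ (by simp [ht]),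
      ← Finset.add_sum_erase t _ (Finset.mem_insert_self _ _)]
    simp [iterDeriv_zero]
  rw [hsum] at h
  obtain ⟨ν, hν, h⟩ := exists_mem_exps_of_sum h
  refine ⟨ν, Finset.ne_of_mem_erase hν, exists_of_mem_exps_leibniz fun h0 => h ?_⟩
  simp [h0]

theorem degree_leibniz_shift (ν : Fin n →₀ ℕ) :
    ((ν.mapDomain xiv + ν.mapDomain xv : Expo n)).degree = 2 * ν.degree := by
  rw [map_add, Finsupp.degree_mapDomain, Finsupp.degree_mapDomain, two_mul]

theorem eDeg_leibniz_shift (ν : Fin n →₀ ℕ) :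
    eDeg (ν.mapDomain xiv + ν.mapDomain xv : Expo n) = ν.degree := by
  rw [eDeg_add, eDeg_mapDomain_xiv, eDeg_mapDomain_xv, add_zero]

/-- The correction terms of the Leibniz rule have smaller `e`-degree, and each derivation costs at
most `2` in total degree. -/
theorem exists_lt_of_mem_exps_dmul_sub_mul {A B : Sym n K} (hA : IsDHat A) {μ : Expo n}
    (h : μ ∈ Exps (dmul A B - A * B)) :
    ∃ α ∈ Exps A, ∃ β ∈ Exps B, μ ≤ α + β ∧ eDeg μ < eDeg α + eDeg β ∧
      α.degree + β.degree ≤ μ.degree + 2 * eDeg α := by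
  obtain ⟨ν, hν, α, hα, β, hβ, heq, hle⟩ := exists_of_mem_exps_dmul_sub_mul hA h
  have h1 := congrArg eDeg heq
  have h2 := congrArg Finsupp.degree heq
  rw [eDeg_add, eDeg_leibniz_shift, eDeg_add] at h1
  rw [map_add, degree_leibniz_shift, map_add] at h2
  have h3 : ν.degree ≠ 0 := fun h0 => hν ((Finsupp.degree_eq_zero_iff ν).mp h0)
  exact ⟨α, hα, β, hβ, heq ▸ le_self_add, by lia, by lia⟩

theorem exists_of_mem_exps_dmul {A B : Sym n K} (hA : IsDHat A) {μ : Expo n}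
    (h : μ ∈ Exps (dmul A B)) :
    ∃ α ∈ Exps A, ∃ β ∈ Exps B, μ ≤ α + β ∧ eDeg μ ≤ eDeg α + eDeg β ∧
      α.degree + β.degree ≤ μ.degree + 2 * eDeg α := by
  rw [← sub_add_cancel (dmul A B) (A * B)] at h
  rcases exps_add_subset _ _ h with h | h
  · obtain ⟨α, hα, β, hβ, h1, h2, h3⟩ := exists_lt_of_mem_exps_dmul_sub_mul hA h
    exact ⟨α, hα, β, hβ, h1, h2.le, h3⟩
  · obtain ⟨α, hα, β, hβ, rfl⟩ := exists_mem_exps_of_mul h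
    exact ⟨α, hα, β, hβ, le_rfl, (eDeg_add α β).le, by rw [map_add]; lia⟩

theorem IsD.dmul {A B : Sym n K} (hA : IsD A) (hB : IsD B) : IsD (dmul A B) :=
  hA.of_le_add hB fun _ hμ =>
    let ⟨α, hα, β, hβ, h, _⟩ := exists_of_mem_exps_dmul hA.isDHat hμ
    ⟨α, hα, β, hβ, h⟩

/-- The degree estimate `(T(i) ∩ D(d)) · T(j) ⊆ T(i + j - 2d)`. -/
theorem inT_dmul {i j : ℤ} {A B : Sym n K} (hA : IsDHat A) (hiA : InT i A) (hjB : InT j B) :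
    InT (i + j - 2 * (ordE A : ℤ)) (dmul A B) := by
  intro μ hμ
  obtain ⟨α, hα, β, hβ, -, -, h⟩ := exists_of_mem_exps_dmul hA hμ
  have h1 := hiA α hα
  have h2 := hjB β hβ
  have h3 := eDeg_le_ordE hA hα
  lia

/-! ### The orders and leading terms -/

section Order

variable {m : MonomialOrder (Var n)} {μ ν κ : Expo n}

theorem ltD_iff_toLex : ltD m μ ν ↔
    toLex (eDeg μ, toLex (OrderDual.toDual (xDeg μ), m.toSyn μ)) <
      toLex (eDeg ν, toLex (OrderDual.toDual (xDeg ν), m.toSyn ν)) := by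
  simp [ltD, Prod.Lex.toLex_lt_toLex]

theorem ltR_iff_toLex : ltR m μ ν ↔
    toLex (OrderDual.toDual μ.degree, m.toSyn μ) <
      toLex (OrderDual.toDual ν.degree, m.toSyn ν) := by
  simp [ltR, Prod.Lex.toLex_lt_toLex]

theorem ltD_asymm (h : ltD m μ ν) : ¬ ltD m ν μ := by
  rw [ltD_iff_toLex] at *
  exact h.not_gt

theorem ltR_asymm (h : ltR m μ ν) : ¬ ltR m ν μ := by
  rw [ltR_iff_toLex] at *
  exact h.not_gt

theorem ltR_trans (h : ltR m μ ν) (h' : ltR m ν κ) : ltR m μ κ := by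
  rw [ltR_iff_toLex] at *
  exact h.trans h'

theorem eDeg_le_of_ltD (h : ltD m μ ν) : eDeg μ ≤ eDeg ν := by
  rcases h with h | h
  · exact h.le
  · exact h.1.le

theorem ltD_add_left (κ : Expo n) (h : ltD m μ ν) : ltD m (κ + μ) (κ + ν) := by
  simp only [ltD, eDeg_add, xDeg_add, map_add, add_lt_add_iff_left, add_right_inj] at *
  exact h

theorem ltR_add_left (κ : Expo n) (h : ltR m μ ν) : ltR m (κ + μ) (κ + ν) := by
  simp only [ltR, map_add, add_lt_add_iff_left, add_right_inj] at *
  exact h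

/-- On exponents of equal `e`-degree, `<` and `<_r` agree. -/
theorem ltR_of_ltD (h : ltD m μ ν) (he : eDeg μ = eDeg ν) : ltR m μ ν := by
  simp only [ltD, ltR, degree_eq_xDeg_add_eDeg] at *
  rcases h with h | ⟨-, h | ⟨h, h'⟩⟩
  · lia
  · exact Or.inl (by lia)
  · exact Or.inr ⟨by lia, h'⟩

theorem degree_le_of_ltR (h : ltR m μ ν) : ν.degree ≤ μ.degree := by
  rcases h with h | h
  · exact h.le
  · exact h.1.ge

end Order

/-- `a` is the leading exponent and `l` the leading coefficient of `P` for the strict order `lt`. -/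
structure IsLead (lt : Expo n → Expo n → Prop) (P : Sym n K) (a : Expo n) (l : K) : Prop where
  mem : a ∈ Exps P
  lt_of_ne : ∀ μ ∈ Exps P, μ ≠ a → lt μ a
  coeff_eq : coeff a P = l

namespace IsLead

variable {lt : Expo n → Expo n → Prop} {P : Sym n K} {a : Expo n} {l : K}

theorem ne_zero (h : IsLead lt P a l) : l ≠ 0 := h.coeff_eq ▸ h.mem

theorem leadExp_eq (h : IsLead lt P a l) (hlt : ∀ μ ν, lt μ ν → ¬ lt ν μ) : leadExp lt P = a := by
  have hex : ∃ μ, μ ∈ Exps P ∧ ∀ μ' ∈ Exps P, μ' ≠ μ → lt μ' μ := ⟨a, h.mem, h.lt_of_ne⟩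
  rw [leadExp, dif_pos hex]
  by_contra hne
  exact hlt _ _ (h.lt_of_ne _ hex.choose_spec.1 hne) (hex.choose_spec.2 a h.mem (Ne.symm hne))

theorem leadCoeff_eq (h : IsLead lt P a l) (hlt : ∀ μ ν, lt μ ν → ¬ lt ν μ) :
    leadCoeff lt P = l := by
  rw [leadCoeff, h.leadExp_eq hlt, h.coeff_eq]

theorem mem_exps_sub (h : IsLead lt P a l) {μ : Expo n} (hμ : μ ∈ Exps (P - monomial a l)) :
    μ ∈ Exps P ∧ lt μ a := by
  classical
  rw [mem_exps, map_sub, MvPowerSeries.coeff_monomial] at hμ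
  by_cases hμa : μ = a
  · subst hμa
    simp [h.coeff_eq] at hμ
  · rw [if_neg hμa, sub_zero] at hμ
    exact ⟨hμ, h.lt_of_ne μ hμ hμa⟩

end IsLead

/-- A nonzero polynomial has a leading exponent for every order that is pulled back from a linear
order along an injective map. -/
theorem exists_isLead {α : Type*} [LinearOrder α] (f : Expo n → α) (hf : Function.Injective f)
    {lt : Expo n → Expo n → Prop} (hlt : ∀ μ ν, lt μ ν ↔ f μ < f ν) {P : Sym n K} (hP : IsD P)
    (h0 : P ≠ 0) : ∃ a, IsLead lt P a (coeff a P) := by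
  have hne : (Exps P).Nonempty := by
    by_contra! h
    refine h0 (MvPowerSeries.ext fun μ => ?_)
    simpa using coeff_eq_zero_of_notMem (P := P) (μ := μ) (by simp [h])
  obtain ⟨a, ha, hmax⟩ := Set.exists_max_image _ f hP hne
  exact ⟨a, ha, fun μ hμ hμa => (hlt μ a).mpr ((hmax μ hμ).lt_of_ne (hf.ne hμa)), rfl⟩

theorem isLead_ltD (m : MonomialOrder (Var n)) {P : Sym n K} (hP : IsD P) (h0 : P ≠ 0) :
    IsLead (ltD m) P (leadExp (ltD m) P) (leadCoeff (ltD m) P) := by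
  obtain ⟨a, h⟩ := exists_isLead
    (fun μ => toLex (eDeg μ, toLex (OrderDual.toDual (xDeg μ), m.toSyn μ)))
    (fun μ ν hμν => m.toSyn.injective (by simp_all)) (lt := ltD m)
    (fun _ _ => ltD_iff_toLex) hP h0
  rwa [h.leadExp_eq fun _ _ => ltD_asymm, h.leadCoeff_eq fun _ _ => ltD_asymm]

theorem isLead_ltR (m : MonomialOrder (Var n)) {P : Sym n K} (hP : IsD P) (h0 : P ≠ 0) :
    IsLead (ltR m) P (leadExp (ltR m) P) (leadCoeff (ltR m) P) := by
  obtain ⟨a, h⟩ := exists_isLead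
    (fun μ => toLex (OrderDual.toDual μ.degree, m.toSyn μ))
    (fun μ ν hμν => m.toSyn.injective (by simp_all)) (lt := ltR m)
    (fun _ _ => ltR_iff_toLex) hP h0
  rwa [h.leadExp_eq fun _ _ => ltR_asymm, h.leadCoeff_eq fun _ _ => ltR_asymm]

theorem IsLead.ordE_eq {m : MonomialOrder (Var n)} {P : Sym n K} {a : Expo n} {l : K}
    (h : IsLead (ltD m) P a l) : ordE P = eDeg a := by
  have hle : ∀ μ ∈ Exps P, eDeg μ ≤ eDeg a := fun μ hμ => by
    by_cases hμa : μ = a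
    · rw [hμa]
    · exact eDeg_le_of_ltD (h.lt_of_ne μ hμ hμa)
  exact le_antisymm (csSup_le ⟨_, a, h.mem, rfl⟩ (by rintro _ ⟨μ, hμ, rfl⟩; exact hle μ hμ))
    (eDeg_le_ordE ⟨_, hle⟩ h.mem)

theorem IsLead.inE {m : MonomialOrder (Var n)} {P : Sym n K} {a : Expo n} {l : K}
    (h : IsLead (ltD m) P a l) : IsLead (ltR m) (inE P) a l where
  mem := mem_exps_part.mpr ⟨h.ordE_eq.symm, h.mem⟩
  lt_of_ne μ hμ hne := by
    obtain ⟨hμe, hμP⟩ := mem_exps_part.mp hμ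
    exact ltR_of_ltD (h.lt_of_ne μ hμP hne) (hμe.trans h.ordE_eq)
  coeff_eq := by
    classical
    rw [DDiv.inE, coeff_part, if_pos (by exact h.ordE_eq.symm), h.coeff_eq]

/-! ### Division by leading terms -/

section MonoDiv

variable {s : ℕ} {a : Fin s → Expo n} {l : Fin s → K}

theorem InDelta.eq {i j : Fin s} {μ : Expo n} (hi : InDelta a i μ) (hj : InDelta a j μ) :
    i = j := by
  rcases lt_trichotomy i j with h | h | h
  · exact absurd hi.1 (hj.2 i h)
  · exact h
  · exact absurd hj.1 (hi.2 j h)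

theorem InDelta.not_inDeltaBar {i : Fin s} {μ : Expo n} (hi : InDelta a i μ) :
    ¬ InDeltaBar a μ := fun h => h i hi.1

theorem exists_inDelta {μ : Expo n} (h : ¬ InDeltaBar a μ) : ∃ i, InDelta a i μ := by
  have h' : ({i | a i ≤ μ} : Set (Fin s)).Nonempty := by
    simpa [InDeltaBar, Set.Nonempty] using h
  obtain ⟨i, hi, hmin⟩ := wellFounded_lt.has_min _ h'
  exact ⟨i, hi, fun j hj haj => hmin j haj hj⟩

open Classical in
/-- The `i`-th quotient of the division of `F` by the terms `l j • x ^ (a j)`. -/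
noncomputable def divQuot (a : Fin s → Expo n) (l : Fin s → K) (F : Sym n K) (i : Fin s) :
    Sym n K :=
  fun μ => if InDelta a i (a i + μ) then coeff (a i + μ) F / l i else 0

open Classical in
theorem coeff_divQuot (F : Sym n K) (i : Fin s) (μ : Expo n) :
    coeff μ (divQuot a l F i) = if InDelta a i (a i + μ) then coeff (a i + μ) F / l i else 0 :=
  rfl

theorem mem_exps_divQuot {F : Sym n K} {i : Fin s} {μ : Expo n}
    (h : μ ∈ Exps (divQuot a l F i)) : InDelta a i (a i + μ) ∧ a i + μ ∈ Exps F := by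
  classical
  rw [mem_exps, coeff_divQuot] at h
  by_cases hi : InDelta a i (a i + μ)
  · rw [if_pos hi] at h
    exact ⟨hi, fun h0 => h (by rw [h0, zero_div])⟩
  · rw [if_neg hi] at h
    exact absurd rfl h

theorem divQuot_sub (F G : Sym n K) (i : Fin s) :
    divQuot a l (F - G) i = divQuot a l F i - divQuot a l G i := by
  classical
  ext μ
  simp only [map_sub, coeff_divQuot]
  split_ifs
  · exact sub_div _ _ _
  · exact (sub_zero _).symm

theorem IsDHat.divQuot {F : Sym n K} (hF : IsDHat F) (i : Fin s) : IsDHat (divQuot a l F i) := by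
  obtain ⟨e, he⟩ := hF
  refine ⟨e, fun μ hμ => ?_⟩
  have := he _ (mem_exps_divQuot hμ).2
  rw [eDeg_add] at this
  lia

theorem IsD.divQuot {F : Sym n K} (hF : IsD F) (i : Fin s) : IsD (divQuot a l F i) :=
  (hF.preimage (add_right_injective (a i)).injOn).subset fun _ hμ => (mem_exps_divQuot hμ).2

/-- Division by the leading terms is exact: it recombines to the dividend. -/
theorem sum_divQuot_mul_add_part (hl : ∀ i, l i ≠ 0) (F : Sym n K) :
    ∑ i, divQuot a l F i * monomial (a i) (l i) + part {μ | InDeltaBar a μ} F = F := by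
  classical
  ext μ
  have hterm : ∀ i, coeff μ (divQuot a l F i * monomial (a i) (l i)) =
      if InDelta a i μ then coeff μ F else 0 := by
    intro i
    rw [coeff_mul_monomial]
    by_cases hle : a i ≤ μ
    · rw [if_pos hle, coeff_divQuot, add_tsub_cancel_of_le hle]
      split_ifs
      · exact div_mul_cancel₀ _ (hl i)
      · exact zero_mul _
    · rw [if_neg hle, if_neg fun h => hle h.1]
  rw [map_add, map_sum, coeff_part, Finset.sum_congr rfl fun i _ => hterm i]
  by_cases hbar : InDeltaBar a μ
  · rw [if_pos (by exact hbar), Finset.sum_eq_zero fun i _ => if_neg fun h => h.not_inDeltaBar hbar,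
      zero_add]
  · obtain ⟨i, hi⟩ := exists_inDelta hbar
    rw [if_neg (by exact hbar), Finset.sum_eq_single i (fun j _ hj => if_neg fun h => hj (h.eq hi))
      (by simp), if_pos hi, add_zero]

/-- Quotients with the prescribed exponents are recovered from the dividend. -/
theorem divQuot_sum_mul_add (hl : ∀ i, l i ≠ 0) {Q : Fin s → Sym n K} {R : Sym n K}
    (hQ : ∀ i, ∀ μ ∈ Exps (Q i), InDelta a i (a i + μ)) (hR : ∀ μ ∈ Exps R, InDeltaBar a μ)
    (i : Fin s) : divQuot a l (∑ j, Q j * monomial (a j) (l j) + R) i = Q i := by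
  classical
  ext μ
  rw [coeff_divQuot]
  by_cases hi : InDelta a i (a i + μ)
  · have hR0 : coeff (a i + μ) R = 0 :=
      coeff_eq_zero_of_notMem fun h => hi.not_inDeltaBar (hR _ h)
    rw [if_pos hi, map_add, hR0, add_zero, map_sum, Finset.sum_eq_single i]
    · rw [add_comm, MvPowerSeries.coeff_add_mul_monomial, mul_div_cancel_right₀ _ (hl i)]
    · intro j _ hj
      rw [coeff_mul_monomial]
      split_ifs with hle
      · rw [coeff_eq_zero_of_notMem, zero_mul]
        intro h
        have := hQ j _ h
        rw [add_tsub_cancel_of_le hle] at this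
        exact hj (this.eq hi)
      · rfl
    · simp
  · rw [if_neg hi]
    exact (coeff_eq_zero_of_notMem fun h => hi (hQ i μ h)).symm

end MonoDiv

/-! ### Castro division as a fixed point -/

section Castro

variable {m : MonomialOrder (Var n)} {s : ℕ} {Ps : Fin s → Sym n K} {a : Fin s → Expo n}
  {l : Fin s → K}

/-- The error made when the division of `c` by the leading terms of the `P_i` is taken for a
division of `c` by the operators `P_i`.  The Castro division of `P` is the division by leading
terms of the solution `c` of `c = P - defect c`. -/
noncomputable def defect (Ps : Fin s → Sym n K) (a : Fin s → Expo n) (l : Fin s → K)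
    (c : Sym n K) : Sym n K :=
  ∑ i, (dmul (divQuot a l c i) (Ps i) - divQuot a l c i * monomial (a i) (l i))

theorem defect_sub {c c' : Sym n K} (hc : IsDHat c) (hc' : IsDHat c') :
    defect Ps a l (c - c') = defect Ps a l c - defect Ps a l c' := by
  unfold defect
  rw [← Finset.sum_sub_distrib]
  refine Finset.sum_congr rfl fun i _ => ?_
  rw [divQuot_sub, dmul_sub_left (hc.divQuot i) (hc'.divQuot i), sub_mul]
  abel

/-- Every term of the error lies below a term `ν` of the dividend.  It has total degree at least
that of `ν`, unless its `e`-degree is smaller; in that case the loss in total degree is at most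
`|a i| + 2 (eDeg ν - ord_e (P_i))`, where `ν` lies in `Δ^i`. -/
theorem exists_of_mem_exps_defect (hlead : ∀ i, IsLead (ltD m) (Ps i) (a i) (l i)) {c : Sym n K}
    (hc : IsDHat c) {μ : Expo n} (h : μ ∈ Exps (defect Ps a l c)) :
    ∃ i, ∃ ν ∈ Exps c, ltD m μ ν ∧ eDeg (a i) ≤ eDeg ν ∧
      ν.degree ≤ μ.degree + ((a i).degree + 2 * (eDeg ν - eDeg (a i))) := by
  obtain ⟨i, -, h⟩ := exists_mem_exps_of_sum h
  have hq := hc.divQuot (a := a) (l := l) i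
  have hsplit : dmul (divQuot a l c i) (Ps i) - divQuot a l c i * monomial (a i) (l i) =
      (dmul (divQuot a l c i) (Ps i) - divQuot a l c i * Ps i) +
        divQuot a l c i * (Ps i - monomial (a i) (l i)) := by
    rw [mul_sub]
    abel
  rw [hsplit] at h
  rcases exps_add_subset _ _ h with h | h
  · obtain ⟨α, hα, β, hβ, -, he, hd⟩ := exists_lt_of_mem_exps_dmul_sub_mul hq h
    have hβe := eDeg_le_ordE ⟨eDeg (a i), fun ρ hρ => by
      by_cases hρa : ρ = a i
      · rw [hρa]
      · exact eDeg_le_of_ltD ((hlead i).lt_of_ne ρ hρ hρa)⟩ hβ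
    rw [(hlead i).ordE_eq] at hβe
    refine ⟨i, _, (mem_exps_divQuot hα).2, Or.inl ?_, ?_, ?_⟩
    · rw [eDeg_add]
      lia
    · rw [eDeg_add]
      lia
    · rw [eDeg_add, map_add]
      lia
  · obtain ⟨α, hα, β, hβ, rfl⟩ := exists_mem_exps_of_mul h
    refine ⟨i, _, (mem_exps_divQuot hα).2, ?_, ?_, ?_⟩
    · rw [add_comm (a i)]
      exact ltD_add_left α ((hlead i).mem_exps_sub hβ).2
    · rw [eDeg_add]
      lia
    · rw [map_add, map_add]
      lia

/-- Among exponents of bounded `e`-degree there is no infinite sequence that increases for `<`. -/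
theorem wellFounded_ltD_swap (m : MonomialOrder (Var n)) (e : ℕ) :
    WellFounded fun ν μ : Expo n => ltD m μ ν ∧ eDeg ν ≤ e := by
  refine Subrelation.wf ?_ (InvImage.wf (fun μ : Expo n => toLex (e - eDeg μ, toLex (xDeg μ,
    {κ : Expo n | κ.degree = μ.degree ∧ m.toSyn μ < m.toSyn κ}.ncard)))
    (wellFounded_lt (α := ℕ ×ₗ ℕ ×ₗ ℕ)))
  rintro ν μ ⟨h, he⟩
  simp only [InvImage, Prod.Lex.toLex_lt_toLex]
  rcases h with h | ⟨h1, h | ⟨h2, h3⟩⟩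
  · exact Or.inl (by lia)
  · exact Or.inr ⟨by rw [h1], Or.inl h⟩
  · have hdeg : ν.degree = μ.degree := by
      rw [degree_eq_xDeg_add_eDeg, degree_eq_xDeg_add_eDeg, h1, h2]
    refine Or.inr ⟨by rw [h1], Or.inr ⟨h2.symm, Set.ncard_lt_ncard ?_ ?_⟩⟩
    · refine ⟨fun κ hκ => ⟨hκ.1.trans hdeg, h3.trans hκ.2⟩, fun hsub => ?_⟩
      exact lt_irrefl _ (hsub (show ν ∈ _ from ⟨hdeg, h3⟩)).2
    · exact (Finsupp.finite_of_degree_eq μ.degree).subset fun κ hκ => hκ.1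

theorem coeff_defect_eq (hlead : ∀ i, IsLead (ltD m) (Ps i) (a i) (l i)) {c c' : Sym n K}
    (hc : IsDHat c) (hc' : IsDHat c') {μ : Expo n}
    (h : ∀ ν, ltD m μ ν → coeff ν c = coeff ν c') :
    coeff μ (defect Ps a l c) = coeff μ (defect Ps a l c') := by
  rw [← sub_eq_zero, ← map_sub, ← defect_sub hc hc']
  refine coeff_eq_zero_of_notMem fun hμ => ?_
  obtain ⟨-, ν, hν, hlt, -⟩ := exists_of_mem_exps_defect hlead (hc.sub hc') hμ
  exact hν (by rw [map_sub, h ν hlt, sub_self])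

theorem exists_eq_sub_defect (hlead : ∀ i, IsLead (ltD m) (Ps i) (a i) (l i)) {P : Sym n K}
    (hP : IsDHat P) : ∃ c, IsDHat c ∧ c = P - defect Ps a l c := by
  classical
  obtain ⟨e, he⟩ := hP
  have wf := wellFounded_ltD_swap m e
  -- The coefficient of `c` at `μ` is determined by those at the larger exponents.
  let c : Sym n K := wf.fix fun μ rec => coeff μ P -
    coeff μ (defect Ps a l fun ν => if h : ltD m μ ν ∧ eDeg ν ≤ e then rec ν h else 0)
  let up (μ : Expo n) : Sym n K := part {ν | ltD m μ ν ∧ eDeg ν ≤ e} c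
  have hfix : ∀ μ, coeff μ c = coeff μ P - coeff μ (defect Ps a l (up μ)) := by
    intro μ
    change wf.fix _ μ = _
    rw [wf.fix_eq]
    congr 3
    funext ν
    by_cases hν : ltD m μ ν ∧ eDeg ν ≤ e
    · exact (dif_pos hν).trans (if_pos hν).symm
    · exact (dif_neg hν).trans (if_neg hν).symm
  have hup : ∀ μ, IsDHat (up μ) := fun μ => ⟨e, fun ν hν => (mem_exps_part.mp hν).1.2⟩
  have hce : ∀ μ ∈ Exps c, eDeg μ ≤ e := by
    intro μ hμ
    by_contra hgt
    refine hμ ?_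
    rw [hfix, coeff_eq_zero_of_notMem fun h => hgt (he μ h), zero_sub, neg_eq_zero]
    refine coeff_eq_zero_of_notMem fun h => ?_
    obtain ⟨-, ν, hν, hlt, -⟩ := exists_of_mem_exps_defect hlead (hup μ) h
    exact hgt ((eDeg_le_of_ltD hlt).trans (mem_exps_part.mp hν).1.2)
  refine ⟨c, ⟨e, hce⟩, MvPowerSeries.ext fun μ => ?_⟩
  rw [hfix, map_sub, coeff_defect_eq hlead (hup μ) ⟨e, hce⟩]
  intro ν hν
  rw [coeff_part]
  split_ifs with h
  · rfl
  · exact (coeff_eq_zero_of_notMem fun h' => h ⟨hν, hce ν h'⟩).symm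

theorem eq_of_eq_sub_defect (hlead : ∀ i, IsLead (ltD m) (Ps i) (a i) (l i)) {P c c' : Sym n K}
    (hc : IsDHat c) (hc' : IsDHat c') (h : c = P - defect Ps a l c)
    (h' : c' = P - defect Ps a l c') : c = c' := by
  obtain ⟨e, he⟩ := hc.sub hc'
  ext μ
  induction μ using (wellFounded_ltD_swap m e).induction with
  | h μ ih =>
    have hμ := coeff_defect_eq (Ps := Ps) (a := a) (l := l) hlead hc hc' (μ := μ) fun ν hν => by
      by_cases hνe : eDeg ν ≤ e
      · exact ih ν ⟨hν, hνe⟩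
      · rw [← sub_eq_zero, ← map_sub]
        exact coeff_eq_zero_of_notMem fun h => hνe (he ν h)
    rw [h, h', map_sub, map_sub, hμ]

/-- `Q` and `R` are the quotients and the remainder of Castro's division of `P` by the `P_i`.  This
is `IsDHatDivision` with the leading exponents of the `P_i` replaced by an arbitrary family `a`. -/
structure IsCastro (Ps : Fin s → Sym n K) (a : Fin s → Expo n) (P : Sym n K)
    (Q : Fin s → Sym n K) (R : Sym n K) : Prop where
  isDHat_quot : ∀ i, IsDHat (Q i)
  isDHat_rem : IsDHat R
  eq : P = ∑ i, dmul (Q i) (Ps i) + R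
  quot : ∀ i, ∀ μ ∈ Exps (Q i), InDelta a i (a i + μ)
  rem : ∀ μ ∈ Exps R, InDeltaBar a μ

theorem isCastro_of_eq_sub_defect (hl : ∀ i, l i ≠ 0) {P c : Sym n K}
    (hc : IsDHat c) (h : c = P - defect Ps a l c) :
    IsCastro Ps a P (divQuot a l c) (part {μ | InDeltaBar a μ} c) where
  isDHat_quot := hc.divQuot
  isDHat_rem := hc.part _
  eq := by
    have h1 := sum_divQuot_mul_add_part (a := a) hl c
    have h2 : P = c + defect Ps a l c := by rw [← sub_eq_iff_eq_add, ← h]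
    rw [defect, Finset.sum_sub_distrib] at h2
    rw [h2]
    nth_rw 1 [← h1]
    abel
  quot _ _ hμ := (mem_exps_divQuot hμ).1
  rem _ hμ := (mem_exps_part.mp hμ).1

theorem IsCastro.unique (hlead : ∀ i, IsLead (ltD m) (Ps i) (a i) (l i)) {P R R' : Sym n K}
    {Q Q' : Fin s → Sym n K} (h : IsCastro Ps a P Q R) (h' : IsCastro Ps a P Q' R') :
    Q' = Q ∧ R' = R := by
  have hl : ∀ i, l i ≠ 0 := fun i => (hlead i).ne_zero
  have key : ∀ {Q : Fin s → Sym n K} {R : Sym n K}, IsCastro Ps a P Q R →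
      IsDHat (∑ i, Q i * monomial (a i) (l i) + R) ∧
        ∑ i, Q i * monomial (a i) (l i) + R =
          P - defect Ps a l (∑ i, Q i * monomial (a i) (l i) + R) := by
    intro Q R h
    refine ⟨.add (.sum fun i _ => (h.isDHat_quot i).mul ⟨eDeg (a i), fun μ hμ => ?_⟩)
      h.isDHat_rem, ?_⟩
    · rw [MvPowerSeries.eq_of_coeff_monomial_ne_zero hμ]
    · simp only [defect, divQuot_sum_mul_add hl h.quot h.rem, Finset.sum_sub_distrib]
      rw [h.eq]
      abel
  have hc := eq_of_eq_sub_defect hlead (key h').1 (key h).1 (key h').2 (key h).2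
  have hQ : Q' = Q := funext fun i => by
    rw [← divQuot_sum_mul_add hl h'.quot h'.rem i, hc, divQuot_sum_mul_add hl h.quot h.rem i]
  subst hQ
  exact ⟨rfl, add_left_cancel hc⟩

/-- Lower bounds `b` for the total degrees of the terms, depending on the `e`-degree, carry over
from the dividend `P` to the solution `c` of `c = P - defect c`. -/
theorem le_degree_of_eq_sub_defect (hlead : ∀ i, IsLead (ltD m) (Ps i) (a i) (l i))
    {P c : Sym n K} (hc : IsDHat c) (h : c = P - defect Ps a l c) {b : ℕ → ℕ} (hb : Monotone b)
    (hstep : ∀ i k, eDeg (a i) ≤ k + 1 →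
      b k + ((a i).degree + 2 * (k + 1 - eDeg (a i))) ≤ b (k + 1))
    (hP : ∀ μ ∈ Exps P, b (eDeg μ) ≤ μ.degree) : ∀ μ ∈ Exps c, b (eDeg μ) ≤ μ.degree := by
  obtain ⟨e, he⟩ := hc
  intro μ
  induction μ using (wellFounded_ltD_swap m e).induction with
  | h μ ih =>
    intro hμ
    rw [h] at hμ
    rcases exps_sub_subset _ _ hμ with hμ | hμ
    · exact hP μ hμ
    · obtain ⟨i, ν, hν, hlt, hie, hdeg⟩ := exists_of_mem_exps_defect hlead ⟨e, he⟩ hμ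
      have hbν := ih ν ⟨hlt, he ν hν⟩ hν
      rcases (eDeg_le_of_ltD hlt).eq_or_lt with heq | hlt'
      · rw [heq]
        exact hbν.trans (degree_le_of_ltR (ltR_of_ltD hlt heq))
      · obtain ⟨k, hk⟩ := Nat.exists_eq_add_of_lt hlt'
        have h1 := hstep i (eDeg μ + k) (hk ▸ hie)
        have h2 := hb (Nat.le_add_right (eDeg μ) k)
        rw [← hk] at h1
        lia

end Castro

/-! ### The division of symbols -/

section PowerSeries

variable {m : MonomialOrder (Var n)} {s : ℕ} {g : Fin s → Sym n K} {a : Fin s → Expo n}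
  {l : Fin s → K}

theorem psBody_eq (hg : ∀ i, IsLead (ltR m) (g i) (a i) (l i)) (S : PSState n K s) :
    psBody m g S = ⟨-∑ i, divQuot a l S.F i * (g i - monomial (a i) (l i)),
      fun i => S.q i + divQuot a l S.F i, S.r + part {μ | InDeltaBar a μ} S.F⟩ := by
  have ha : (fun i => leadExp (ltR m) (g i)) = a :=
    funext fun i => (hg i).leadExp_eq fun _ _ => ltR_asymm
  have hl : (fun i => leadCoeff (ltR m) (g i)) = l :=
    funext fun i => (hg i).leadCoeff_eq fun _ _ => ltR_asymm
  subst ha hl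
  rfl

theorem exists_ltR_of_mem_exps_psBody (hg : ∀ i, IsLead (ltR m) (g i) (a i) (l i))
    {S : PSState n K s} {μ : Expo n} (h : μ ∈ Exps (psBody m g S).F) :
    ∃ i, ∃ ν ∈ Exps S.F, ltR m μ ν ∧ ∃ α, ∃ ρ ∈ Exps (g i), μ = α + ρ ∧ ν = α + a i := by
  rw [psBody_eq hg, exps_neg] at h
  obtain ⟨i, -, h⟩ := exists_mem_exps_of_sum h
  obtain ⟨α, hα, ρ, hρ, rfl⟩ := exists_mem_exps_of_mul h
  obtain ⟨hρg, hlt⟩ := (hg i).mem_exps_sub hρ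
  have hν := (mem_exps_divQuot hα).2
  rw [add_comm] at hν
  exact ⟨i, α + a i, hν, ltR_add_left α hlt, α, ρ, hρg, rfl, rfl⟩

/-- The loop invariant of the division of the `e`-homogeneous symbol `f` of `e`-degree `k` by the
`e`-homogeneous symbols `g_i`. -/
structure PSInv (g : Fin s → Sym n K) (a : Fin s → Expo n) (k : ℕ) (f : Sym n K)
    (S : PSState n K s) : Prop where
  isD_F : IsD S.F
  isD_q : ∀ i, IsD (S.q i)
  eDeg_F : ∀ μ ∈ Exps S.F, eDeg μ = k
  eDeg_q : ∀ i, ∀ μ ∈ Exps (S.q i), eDeg (a i + μ) = k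
  quot : ∀ i, ∀ μ ∈ Exps (S.q i), InDelta a i (a i + μ)
  rem : ∀ μ ∈ Exps S.r, InDeltaBar a μ
  eq : f = ∑ i, S.q i * g i + S.r + S.F

theorem PSInv.init {k : ℕ} {f : Sym n K} (hf : IsD f) (hk : ∀ μ ∈ Exps f, eDeg μ = k) :
    PSInv g a k f ⟨f, fun _ => 0, 0⟩ where
  isD_F := hf
  isD_q _ := IsD.zero
  eDeg_F := hk
  eDeg_q _ _ h := absurd (map_zero _) h
  quot _ _ h := absurd (map_zero _) h
  rem _ h := absurd (map_zero _) h
  eq := by simp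

theorem PSInv.psBody (hg : ∀ i, IsLead (ltR m) (g i) (a i) (l i)) (hgD : ∀ i, IsD (g i))
    (hge : ∀ i, ∀ ρ ∈ Exps (g i), eDeg ρ = eDeg (a i)) {k : ℕ} {f : Sym n K} {S : PSState n K s}
    (h : PSInv g a k f S) : PSInv g a k f (psBody m g S) where
  isD_F := by
    rw [psBody_eq hg]
    exact (IsD.sum fun i _ => (h.isD_F.divQuot i).mul
      ((hgD i).subset fun _ hμ => ((hg i).mem_exps_sub hμ).1)).neg
  isD_q i := by
    rw [psBody_eq hg]
    exact (h.isD_q i).add (h.isD_F.divQuot i)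
  eDeg_F μ hμ := by
    obtain ⟨i, ν, hν, -, α, ρ, hρ, rfl, rfl⟩ := exists_ltR_of_mem_exps_psBody hg hμ
    rw [eDeg_add, hge i ρ hρ, ← eDeg_add, h.eDeg_F _ hν]
  eDeg_q i μ hμ := by
    rw [psBody_eq hg] at hμ
    rcases exps_add_subset _ _ hμ with hμ | hμ
    · exact h.eDeg_q i μ hμ
    · exact h.eDeg_F _ (mem_exps_divQuot hμ).2
  quot i μ hμ := by
    rw [psBody_eq hg] at hμ
    rcases exps_add_subset _ _ hμ with hμ | hμ
    · exact h.quot i μ hμ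
    · exact (mem_exps_divQuot hμ).1
  rem μ hμ := by
    rw [psBody_eq hg] at hμ
    rcases exps_add_subset _ _ hμ with hμ | hμ
    · exact h.rem μ hμ
    · exact (mem_exps_part.mp hμ).1
  eq := by
    have hF := sum_divQuot_mul_add_part (a := a) (fun i => (hg i).ne_zero) S.F
    rw [psBody_eq hg]
    simp only [add_mul, mul_sub, Finset.sum_add_distrib, Finset.sum_sub_distrib]
    rw [h.eq]
    nth_rw 1 [← hF]
    abel

theorem PSInv.of_whileRun (hg : ∀ i, IsLead (ltR m) (g i) (a i) (l i)) (hgD : ∀ i, IsD (g i))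
    (hge : ∀ i, ∀ ρ ∈ Exps (g i), eDeg ρ = eDeg (a i)) {k B : ℕ} {f : Sym n K}
    {S T : PSState n K s} (hrun : WhileRun (psCond m B) (DDiv.psBody m g) S T)
    (h : PSInv g a k f S) : PSInv g a k f T ∧ ∀ μ ∈ Exps T.F, B ≤ μ.degree := by
  induction hrun with
  | done S hcond =>
    refine ⟨h, fun μ hμ => ?_⟩
    have h0 : S.F ≠ 0 := fun h0 => hμ (by rw [h0, map_zero])
    have hlead := isLead_ltR m h.isD_F h0
    have hB : B ≤ (leadExp (ltR m) S.F).degree := not_lt.mp fun hlt => hcond ⟨h0, hlt⟩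
    by_cases hμa : μ = leadExp (ltR m) S.F
    · rwa [hμa]
    · exact hB.trans (degree_le_of_ltR (hlead.lt_of_ne μ hμ hμa))
  | step S T _ _ ih => exact ih (h.psBody hg hgD hge)

/-- The loop terminates: the exponents of total degree `< B` that are at most some exponent of
`F` for `<_r` form a finite set, which shrinks at every step. -/
theorem exists_whileRun (hg : ∀ i, IsLead (ltR m) (g i) (a i) (l i)) (hgD : ∀ i, IsD (g i))
    (hge : ∀ i, ∀ ρ ∈ Exps (g i), eDeg ρ = eDeg (a i)) {k : ℕ} (B : ℕ) {f : Sym n K}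
    {S : PSState n K s} (h : PSInv g a k f S) :
    ∃ T, WhileRun (psCond m B) (psBody m g) S T := by
  let below (S : PSState n K s) : Set (Expo n) :=
    {μ | μ.degree < B ∧ ∃ ν ∈ Exps S.F, μ = ν ∨ ltR m μ ν}
  induction hc : (below S).ncard using Nat.strong_induction_on generalizing S with
  | _ c ih =>
    by_cases hcond : psCond m B S
    · have hlead := isLead_ltR m h.isD_F hcond.1
      have hsub : below (psBody m g S) ⊂ below S := by
        refine ⟨fun μ hμ => ?_, fun hsub => ?_⟩
        · obtain ⟨hμB, ν, hν, hle⟩ := hμ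
          obtain ⟨-, κ, hκ, hlt, -⟩ := exists_ltR_of_mem_exps_psBody hg hν
          refine ⟨hμB, κ, hκ, Or.inr ?_⟩
          rcases hle with rfl | hle
          · exact hlt
          · exact ltR_trans hle hlt
        · obtain ⟨-, ν, hν, hle⟩ := hsub ⟨hcond.2, _, hlead.mem, Or.inl rfl⟩
          obtain ⟨-, κ, hκ, hlt, -⟩ := exists_ltR_of_mem_exps_psBody hg hν
          have hlt' : ltR m (leadExp (ltR m) S.F) κ := by
            rcases hle with hle | hle
            · rwa [hle]
            · exact ltR_trans hle hlt
          by_cases hκa : κ = leadExp (ltR m) S.F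
          · rw [hκa] at hlt'
            exact ltR_asymm hlt' hlt'
          · exact ltR_asymm hlt' (hlead.lt_of_ne κ hκ hκa)
      have hfin : (below S).Finite := (Finsupp.finite_of_degree_lt B).subset fun _ hμ => hμ.1
      obtain ⟨T, hT⟩ := ih _ (hc ▸ Set.ncard_lt_ncard hsub hfin) (h.psBody hg hgD hge) rfl
      exact ⟨T, .step S T hcond hT⟩
    · exact ⟨S, .done S hcond⟩

end PowerSeries

/-! ### The division of operators -/

section Operators

variable {m : MonomialOrder (Var n)} {s : ℕ} {Ps : Fin s → Sym n K} {a : Fin s → Expo n}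
  {l : Fin s → K}

/-- The loop invariant of the division of `P` by the `P_i`, when the loop index still has to run
through `k - 1, …, 0`: in `e`-degree `j ≥ k`, the terms of `R` of total degree
`< N + M_0 + ⋯ + M_j` are reduced. -/
structure DInv (m : MonomialOrder (Var n)) (Ps : Fin s → Sym n K) (a : Fin s → Expo n) (N : ℕ)
    (P : Sym n K) (k : ℕ) (S : DState n K s) : Prop where
  isD_R : IsD S.R
  isD_Q : ∀ i, IsD (S.Q i)
  bound : S.bound = N + ∑ j ∈ Finset.range k, Mk m Ps j
  quot : ∀ i, ∀ μ ∈ Exps (S.Q i), InDelta a i (a i + μ)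
  eq : P = ∑ i, dmul (S.Q i) (Ps i) + S.R
  rem : ∀ μ ∈ Exps S.R, k ≤ eDeg μ →
    μ.degree < N + ∑ j ∈ Finset.range (eDeg μ + 1), Mk m Ps j → InDeltaBar a μ

theorem DInv.init {P : Sym n K} (hP : IsD P) (N : ℕ) :
    DInv m Ps a N P (ordE P + 1)
      ⟨fun _ => 0, P, N + ∑ k ∈ Finset.range (ordE P + 1), Mk m Ps k⟩ where
  isD_R := hP
  isD_Q _ := IsD.zero
  bound := rfl
  quot _ _ h := absurd (map_zero _) h
  eq := by simp [dmul_zero_left]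
  rem μ hμ hk := by
    have := eDeg_le_ordE hP.isDHat hμ
    lia

theorem eDeg_eq_of_mem_exps_inE (hlead : ∀ i, IsLead (ltD m) (Ps i) (a i) (l i)) (i : Fin s)
    {ρ : Expo n} (hρ : ρ ∈ Exps (inE (Ps i))) : eDeg ρ = eDeg (a i) :=
  (mem_exps_part.mp hρ).1.trans (hlead i).ordE_eq

theorem IsD.inE {P : Sym n K} (hP : IsD P) : IsD (inE P) := hP.part _

/-- If `q` has `e`-degree `k - ord_e (P_i)`, then the part of `q P_i` of `e`-degree at least `k` is
the product of symbols `q · in_e (P_i)`. -/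
theorem coeff_dmul_of_le_eDeg {P : Sym n K} (hP : IsD P) {q : Sym n K} (hq : IsDHat q) {k : ℕ}
    (hk : ∀ α ∈ Exps q, eDeg α + ordE P = k) {μ : Expo n} (hμ : k ≤ eDeg μ) :
    coeff μ (dmul q P) = coeff μ (q * inE P) := by
  rw [← sub_eq_zero, ← map_sub]
  refine coeff_eq_zero_of_notMem fun h => ?_
  have hsplit : dmul q P - q * inE P = (dmul q P - q * P) + q * (P - inE P) := by
    rw [mul_sub]
    abel
  rw [hsplit] at h
  rcases exps_add_subset _ _ h with h | h
  · obtain ⟨α, hα, β, hβ, -, hlt, -⟩ := exists_lt_of_mem_exps_dmul_sub_mul hq h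
    have := eDeg_le_ordE hP.isDHat hβ
    have := hk α hα
    lia
  · obtain ⟨α, hα, β, hβ, rfl⟩ := exists_mem_exps_of_mul h
    have hβ' : β ∈ Exps P ∧ eDeg β ≠ ordE P := by
      classical
      rw [mem_exps, map_sub, inE, coeff_part] at hβ
      by_cases hβe : eDeg β = ordE P
      · rw [if_pos (by exact hβe), sub_self] at hβ
        exact absurd rfl hβ
      · rw [if_neg (by exact hβe), sub_zero] at hβ
        exact ⟨hβ, hβe⟩
    have h1 := eDeg_le_ordE hP.isDHat hβ'.1
    have h2 := hβ'.2
    have h3 := hk α hα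
    rw [eDeg_add] at hμ
    lia

theorem DInv.step (hlead : ∀ i, IsLead (ltD m) (Ps i) (a i) (l i)) (hPs : ∀ i, IsD (Ps i))
    {N k : ℕ} {P : Sym n K} {S S' : DState n K s} (h : DInv m Ps a N P (k + 1) S)
    (hstep : DStep m Ps k S S') : DInv m Ps a N P k S' := by
  classical
  obtain ⟨T, hrun, hR, hQ, hbound⟩ := hstep
  obtain ⟨hT, hTF⟩ := PSInv.of_whileRun (fun i => (hlead i).inE) (fun i => (hPs i).inE)
    (fun i _ => eDeg_eq_of_mem_exps_inE hlead i) hrun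
    (PSInv.init (k := k) (h.isD_R.part _) fun μ hμ => (mem_exps_part.mp hμ).1.1)
  have hcoeff : ∀ μ, k ≤ eDeg μ → coeff μ S'.R = coeff μ S.R -
      coeff μ (part {μ | eDeg μ = k ∧ μ.degree < S.bound} S.R) + coeff μ T.r + coeff μ T.F := by
    intro μ hμ
    have hsum : coeff μ (∑ i, dmul (T.q i) (Ps i)) = coeff μ (∑ i, T.q i * inE (Ps i)) := by
      simp only [map_sum]
      refine Finset.sum_congr rfl fun i _ => coeff_dmul_of_le_eDeg (hPs i) (hT.isD_q i).isDHat
        (fun α hα => ?_) hμ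
      rw [(hlead i).ordE_eq, add_comm, ← eDeg_add, hT.eDeg_q i α hα]
    have hf := congrArg (coeff μ) hT.eq
    rw [map_add, map_add] at hf
    rw [hR, map_sub, hsum, hf]
    ring
  refine ⟨?_, fun i => ?_, ?_, fun i μ hμ => ?_, ?_, fun μ hμ hk hdeg => ?_⟩
  · rw [hR]
    exact h.isD_R.sub (IsD.sum fun i _ => (hT.isD_q i).dmul (hPs i))
  · rw [hQ]
    exact (h.isD_Q i).add (hT.isD_q i)
  · rw [hbound, h.bound, Finset.sum_range_succ]
    lia
  · rw [hQ] at hμ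
    rcases exps_add_subset _ _ hμ with hμ | hμ
    · exact h.quot i μ hμ
    · exact hT.quot i μ hμ
  · rw [hR, h.eq]
    simp only [hQ, dmul_add_left (h.isD_Q _).isDHat (hT.isD_q _).isDHat, Finset.sum_add_distrib]
    abel
  · rcases hk.eq_or_lt with heq | hlt
    · rw [← heq, ← h.bound] at hdeg
      have hF : coeff μ T.F = 0 := coeff_eq_zero_of_notMem fun hF => (hTF μ hF).not_gt hdeg
      rw [mem_exps, hcoeff μ hk, coeff_part, if_pos ⟨heq.symm, hdeg⟩, sub_self, zero_add, hF,
        add_zero] at hμ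
      exact hT.rem μ hμ
    · have hF : coeff μ T.F = 0 := coeff_eq_zero_of_notMem fun hF => hlt.ne' (hT.eDeg_F μ hF)
      rw [mem_exps, hcoeff μ hk, coeff_part, if_neg fun hμ => hlt.ne' hμ.1, sub_zero, hF,
        add_zero] at hμ
      by_cases hr : coeff μ T.r = 0
      · rw [hr, add_zero] at hμ
        exact h.rem μ hμ hlt hdeg
      · exact hT.rem μ hr

theorem DInv.of_dLoop (hlead : ∀ i, IsLead (ltD m) (Ps i) (a i) (l i)) (hPs : ∀ i, IsD (Ps i))
    {N : ℕ} {P : Sym n K} : ∀ {k : ℕ} {S S' : DState n K s}, DLoop m Ps k S S' →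
      DInv m Ps a N P k S → DInv m Ps a N P 0 S'
  | 0, _, _, hrun, h => by
    rw [DLoop] at hrun
    rwa [hrun]
  | _ + 1, _, _, ⟨_, hstep, hrun⟩, h => of_dLoop hlead hPs hrun (h.step hlead hPs hstep)

theorem exists_dLoop (hlead : ∀ i, IsLead (ltD m) (Ps i) (a i) (l i)) (hPs : ∀ i, IsD (Ps i))
    {N : ℕ} {P : Sym n K} (k : ℕ) : ∀ {S : DState n K s}, DInv m Ps a N P k S →
      ∃ S', DLoop m Ps k S S' := by
  induction k with
  | zero => exact fun {S} _ => ⟨S, rfl⟩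
  | succ k ih =>
    intro S h
    obtain ⟨T, hT⟩ := exists_whileRun (m := m) (fun i => (hlead i).inE) (fun i => (hPs i).inE)
      (fun i _ => eDeg_eq_of_mem_exps_inE hlead i) S.bound
      (PSInv.init (k := k) (h.isD_R.part {μ | eDeg μ = k ∧ μ.degree < S.bound})
        fun μ hμ => (mem_exps_part.mp hμ).1.1)
    have hstep : DStep m Ps k S ⟨fun i => S.Q i + T.q i, S.R - ∑ i, dmul (T.q i) (Ps i),
        S.bound - Mk m Ps k⟩ := ⟨T, hT, rfl, fun _ => rfl, rfl⟩
    obtain ⟨S', hS'⟩ := ih (h.step hlead hPs hstep)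
    exact ⟨S', _, hstep, hS'⟩

/-- The terms of the output that are not yet reduced have total degree at least
`N + M_0 + ⋯ + M_k` in `e`-degree `k`; dividing them exactly changes the `i`-th quotient only in
total degree `≥ N - |a i|` and the remainder only in total degree `≥ N`. -/
theorem DInv.agree (hlead : ∀ i, IsLead (ltD m) (Ps i) (a i) (l i)) {N : ℕ} {P R : Sym n K}
    {Q : Fin s → Sym n K} {S : DState n K s} (h : DInv m Ps a N P 0 S)
    (hQR : IsCastro Ps a P Q R) :
    (∀ i, ∀ μ : Expo n, (μ.degree : ℤ) < (N : ℤ) - ((a i).degree : ℤ) →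
      coeff μ (S.Q i) = coeff μ (Q i)) ∧
    ∀ μ : Expo n, μ.degree < N → coeff μ S.R = coeff μ R := by
  classical
  have hl : ∀ i, l i ≠ 0 := fun i => (hlead i).ne_zero
  set b : ℕ → ℕ := fun k => N + ∑ j ∈ Finset.range (k + 1), Mk m Ps j with hbdef
  have hNb : ∀ k, N ≤ b k := fun k => Nat.le_add_right _ _
  have hb : Monotone b := monotone_nat_of_le_succ fun k => by
    simp only [hbdef, Finset.sum_range_succ _ (k + 1)]
    lia
  -- `R₀` consists of the reduced terms of the output remainder, and `E` of the others.
  set R₀ := part {μ | InDeltaBar a μ} S.R with hR₀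
  set E := S.R - R₀ with hE
  have hEexp : ∀ μ ∈ Exps E, b (eDeg μ) ≤ μ.degree := by
    intro μ hμ
    rw [mem_exps, hE, map_sub, hR₀, coeff_part] at hμ
    by_cases hbar : InDeltaBar a μ
    · rw [if_pos (by exact hbar), sub_self] at hμ
      exact absurd rfl hμ
    · rw [if_neg (by exact hbar), sub_zero] at hμ
      exact not_lt.mp fun hlt => hbar (h.rem μ hμ (Nat.zero_le _) hlt)
  obtain ⟨c, hc, hcE⟩ := exists_eq_sub_defect hlead (h.isD_R.sub (h.isD_R.part _)).isDHat (P := E)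
  have hcdeg := le_degree_of_eq_sub_defect hlead hc hcE hb (fun i k hik => by
    have hMk : (a i).degree + 2 * (k + 1 - eDeg (a i)) ≤ Mk m Ps (k + 1) := by
      have := Finset.le_sup (f := fun i => (leadExp (ltD m) (Ps i)).degree +
        2 * (k + 1 - ordE (Ps i))) (s := Finset.univ.filter fun i => ordE (Ps i) ≤ k + 1)
        (b := i) (by simpa [(hlead i).ordE_eq] using hik)
      rwa [(hlead i).leadExp_eq fun _ _ => ltD_asymm, (hlead i).ordE_eq] at this
    simp only [hbdef, Finset.sum_range_succ _ (k + 1)]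
    lia) hEexp
  have hcN : ∀ μ ∈ Exps c, N ≤ μ.degree := fun μ hμ => (hNb _).trans (hcdeg μ hμ)
  have hdiv := isCastro_of_eq_sub_defect hl hc hcE
  have hsum : IsCastro Ps a P (fun i => S.Q i + divQuot a l c i)
      (R₀ + part {μ | InDeltaBar a μ} c) :=
    { isDHat_quot := fun i => (h.isD_Q i).isDHat.add (hdiv.isDHat_quot i)
      isDHat_rem := (h.isD_R.part _).isDHat.add hdiv.isDHat_rem
      eq := by
        simp only [dmul_add_left (h.isD_Q _).isDHat (hdiv.isDHat_quot _), Finset.sum_add_distrib]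
        have h1 : S.R = R₀ + E := by rw [hE]; abel
        nth_rw 1 [h.eq, h1, hdiv.eq]
        abel
      quot := fun i μ hμ => by
        rcases exps_add_subset _ _ hμ with hμ | hμ
        · exact h.quot i μ hμ
        · exact hdiv.quot i μ hμ
      rem := fun μ hμ => by
        rcases exps_add_subset _ _ hμ with hμ | hμ
        · exact (mem_exps_part.mp hμ).1
        · exact hdiv.rem μ hμ }
  obtain ⟨rfl, rfl⟩ := hsum.unique hlead hQR
  refine ⟨fun i μ hμ => ?_, fun μ hμ => ?_⟩
  · have h0 : coeff μ (divQuot a l c i) = 0 := coeff_eq_zero_of_notMem fun h' => by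
      have := hcN _ (mem_exps_divQuot h').2
      rw [map_add] at this
      lia
    rw [map_add, h0, add_zero]
  · have h1 : coeff μ (part {μ | InDeltaBar a μ} c) = 0 := coeff_eq_zero_of_notMem fun h' =>
      (hcN μ (mem_exps_part.mp h').2).not_gt hμ
    have h2 : coeff μ E = 0 := coeff_eq_zero_of_notMem fun h' =>
      ((hNb _).trans (hEexp μ h')).not_gt hμ
    rw [map_add, h1, add_zero, ← sub_eq_zero, ← map_sub, ← hE, h2]

end Operators

end DDiv

theorem mainTheorem2 {n : ℕ} {K : Type*} [Field K] [CharZero K]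
    (m : MonomialOrder (DDiv.Var n)) {s : ℕ} (P : DDiv.Sym n K) (Ps : Fin s → DDiv.Sym n K) (N : ℕ)
    (hN : 0 < N) (hP : DDiv.IsD P) (hPs : ∀ i, DDiv.IsD (Ps i)) (hPs0 : ∀ i, Ps i ≠ 0) :
    -- the algorithm terminates
    (∃ (Qbar : Fin s → DDiv.Sym n K) (Rbar : DDiv.Sym n K),
      DDiv.DHatApproxDivRun m P Ps N Qbar Rbar) ∧
    -- Castro's quotients and remainder exist and are unique
    (∃ (Q : Fin s → DDiv.Sym n K) (R : DDiv.Sym n K),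
      DDiv.IsDHatDivision m P Ps Q R ∧
      (∀ Q' R', DDiv.IsDHatDivision m P Ps Q' R' → Q' = Q ∧ R' = R) ∧
      -- the output is correct
      ∀ Qbar Rbar, DDiv.DHatApproxDivRun m P Ps N Qbar Rbar →
        (∀ i, DDiv.IsD (Qbar i)) ∧ DDiv.IsD Rbar ∧
        P = ∑ i, DDiv.dmul (Qbar i) (Ps i) + Rbar ∧
        (∀ i, ∀ μ : DDiv.Expo n,
          (μ.degree : ℤ) < (N : ℤ) - ((DDiv.leadExp (DDiv.ltD m) (Ps i)).degree : ℤ) →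
          MvPowerSeries.coeff μ (Qbar i) = MvPowerSeries.coeff μ (Q i)) ∧
        (∀ μ : DDiv.Expo n, μ.degree < N →
          MvPowerSeries.coeff μ Rbar = MvPowerSeries.coeff μ R)) ∧
    -- the degree estimate for products
    (∀ (i j : ℤ) (d : ℕ) (A B : DDiv.Sym n K), DDiv.IsDHat A → DDiv.IsDHat B →
      DDiv.InT i A → DDiv.ordE A = d → DDiv.InT j B →
      DDiv.InT (i + j - 2 * (d : ℤ)) (DDiv.dmul A B)) := by
  have hlead := fun i => DDiv.isLead_ltD m (hPs i) (hPs0 i)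
  have hiff : ∀ Q R, DDiv.IsDHatDivision m P Ps Q R ↔
      DDiv.IsCastro Ps (fun i => DDiv.leadExp (DDiv.ltD m) (Ps i)) P Q R := fun Q R =>
    ⟨fun ⟨h1, h2, h3, h4, h5⟩ => ⟨h1, h2, h3, h4, h5⟩,
      fun h => ⟨h.isDHat_quot, h.isDHat_rem, h.eq, h.quot, h.rem⟩⟩
  refine ⟨?_, ?_, ?_⟩
  · obtain ⟨S, hS⟩ := DDiv.exists_dLoop hlead hPs _ (DDiv.DInv.init hP N)
    exact ⟨S.Q, S.R, S.bound, hS⟩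
  · obtain ⟨c, hc, hcP⟩ := DDiv.exists_eq_sub_defect hlead hP.isDHat
    have hdiv := DDiv.isCastro_of_eq_sub_defect (fun i => (hlead i).ne_zero) hc hcP
    refine ⟨_, _, (hiff _ _).mpr hdiv, fun Q' R' h => hdiv.unique hlead ((hiff _ _).mp h), ?_⟩
    rintro Qbar Rbar ⟨b, hrun⟩
    have h := DDiv.DInv.of_dLoop hlead hPs hrun (DDiv.DInv.init hP N)
    obtain ⟨hQ, hR⟩ := h.agree hlead hdiv
    exact ⟨h.isD_Q, h.isD_R, h.eq, hQ, hR⟩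
  · rintro i j d A B hA - hiA rfl hjB
    exact DDiv.inT_dmul hA hiA hjB
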